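/- Let $k$ be a field of characteristic $0$. The Witt (or centerless Virasoro) algebra $W$ is the Lie algebra over $k$ with basis $\{e_n\}_{n\in\mathbb{Z}}$ and Lie bracket $[e_n,e_m]=(m-n)e_{n+m}$, and the positive Witt algebra $W_+$ is the Lie subalgebra of $W$ generated by $\{e_n\}_{n\ge 1}$. For a Lie algebra $L$ over $k$, let $U(L)$ denote its universal enveloping algebra. **Theorem.** The ring $U(W_+)$ is neither left nor right noetherian. Consequently, the ring $U(W)$ is neither left nor right noetherian. Thus, for both $L=W_+$ and $L=W$, the following equivalence holds: $L$ is finite dimensional over $k$ if and only if $U(L)$ is (left and right) noetherian; since neither Lie algebra is finite dimensional, both sides fail in each case. -/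

import Mathlib

/-- The underlying vector space of the Witt algebra over `k`: finitely supported functions `ℤ → k`,
i.e. the free module on symbols `e n`, `n : ℤ`. -/
def WittAlgebra (k : Type*) [CommRing k] : Type _ := ℤ →₀ k

namespace WittAlgebra

noncomputable section

variable (k : Type*) [CommRing k]

instance instAddCommGroup : AddCommGroup (WittAlgebra k) := inferInstanceAs (AddCommGroup (ℤ →₀ k))

instance instModule : Module k (WittAlgebra k) := inferInstanceAs (Module k (ℤ →₀ k))

/-- The standard basis `(e n)` of the Witt algebra, indexed by the integers. -/
def basis : Module.Basis ℤ k (WittAlgebra k) := Module.Basis.ofRepr (LinearEquiv.refl k (ℤ →₀ k))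

/-- The basis vector `e n`. -/
def e (n : ℤ) : WittAlgebra k := basis k n

/-- The bilinear extension of `(e n, e m) ↦ (m - n) • e (n + m)`. -/
def bracketMap : WittAlgebra k →ₗ[k] WittAlgebra k →ₗ[k] WittAlgebra k :=
  (basis k).constr k fun n => (basis k).constr k fun m => ((m - n : ℤ) : k) • e k (n + m)

theorem bracketMap_e (n m : ℤ) :
    bracketMap k (e k n) (e k m) = ((m - n : ℤ) : k) • e k (n + m) := by
  simp only [bracketMap, e, Module.Basis.constr_basis]

theorem bracketMap_self (x : WittAlgebra k) : bracketMap k x x = 0 := by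
  have anti : ∀ x y : WittAlgebra k, bracketMap k x y = -bracketMap k y x := by
    intro x y
    have h : bracketMap k = -(bracketMap k).flip := by
      refine (basis k).ext fun n => (basis k).ext fun m => ?_
      change bracketMap k (e k n) (e k m) = -bracketMap k (e k m) (e k n)
      rw [bracketMap_e, bracketMap_e, add_comm m n, ← neg_smul]
      congr 1
      push_cast
      ring
    exact congrArg (fun f => f x y) h
  induction (basis k).mem_span x using Submodule.span_induction with
  | mem x hx =>
    obtain ⟨n, rfl⟩ := hx
    change bracketMap k (e k n) (e k n) = 0
    rw [bracketMap_e]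
    simp
  | zero => simp
  | add x y _ _ hx hy =>
    rw [map_add, map_add, LinearMap.add_apply, LinearMap.add_apply, hx, hy, anti x y]
    simp
  | smul c x _ hx => simp [hx]

theorem bracketMap_jacobi (x y z : WittAlgebra k) :
    bracketMap k x (bracketMap k y z) =
      bracketMap k (bracketMap k x y) z + bracketMap k y (bracketMap k x z) := by
  let B := bracketMap k
  let A₁ : WittAlgebra k →ₗ[k] WittAlgebra k →ₗ[k] WittAlgebra k →ₗ[k] WittAlgebra k :=
    LinearMap.mk₂ k (fun x y => B x ∘ₗ B y)
      (by intros; ext; simp) (by intros; ext; simp) (by intros; ext; simp) (by intros; ext; simp)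
  let A₂ : WittAlgebra k →ₗ[k] WittAlgebra k →ₗ[k] WittAlgebra k →ₗ[k] WittAlgebra k :=
    LinearMap.mk₂ k (fun x y => B (B x y) + B y ∘ₗ B x)
      (by intros; ext; simp; abel) (by intros; ext; simp)
      (by intros; ext; simp; abel) (by intros; ext; simp)
  have h : A₁ = A₂ := by
    refine (basis k).ext fun a => (basis k).ext fun b => (basis k).ext fun c => ?_
    change bracketMap k (e k a) (bracketMap k (e k b) (e k c)) =
      bracketMap k (bracketMap k (e k a) (e k b)) (e k c) +
        bracketMap k (e k b) (bracketMap k (e k a) (e k c))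
    simp only [bracketMap_e, map_smul, LinearMap.smul_apply, smul_smul]
    rw [show a + b + c = a + (b + c) by ring, show b + (a + c) = a + (b + c) by ring, ← add_smul]
    congr 1
    push_cast
    ring
  exact congrArg (fun f => f x y z) h

instance instLieRing : LieRing (WittAlgebra k) where
  bracket x y := bracketMap k x y
  add_lie x y z := by simp
  lie_add x y z := by simp
  lie_self x := bracketMap_self k x
  leibniz_lie x y z := bracketMap_jacobi k x y z

instance instLieAlgebra : LieAlgebra k (WittAlgebra k) where
  lie_smul c x y := map_smul (bracketMap k x) c y

theorem lie_e (n m : ℤ) : ⁅e k n, e k m⁆ = ((m - n : ℤ) : k) • e k (n + m) :=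
  bracketMap_e k n m

/-- The positive part of the Witt algebra: the Lie subalgebra generated by the `e n`, `n ≥ 1`. -/
def positive : LieSubalgebra k (WittAlgebra k) :=
  LieSubalgebra.lieSpan k (WittAlgebra k) {x | ∃ n : ℤ, 1 ≤ n ∧ x = e k n}

end

end WittAlgebra

/-- A ring is left noetherian if it is noetherian as a left module over itself. -/
def IsLeftNoetherian (A : Type*) [Ring A] : Prop := IsNoetherian A A

/-- A ring is right noetherian if it is noetherian as a right module over itself, i.e. as a module
over the opposite ring acting by right multiplication. -/
def IsRightNoetherian (A : Type*) [Ring A] : Prop := IsNoetherian Aᵐᵒᵖ A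

/-! Over the dual numbers, let `e n` act on Laurent polynomials by x^m ↦ (m + nε) x^(m+n). Modulo ε
the constant 1 is killed by every `e n`, so each b in U(L) sends 1 to c·1 + ε w with c in k. If the
right ideal I consists of the u with image in multiples of ε, then u(εw) = 0 and (ub)(1) = c·u(1). A
finitely generated I would thus have only a finite-dimensional space of values at 1. But second
differences of `e (n - i) * e i` in i lie in I and take the value 2ε x^n (`exists_mem_epsIdeal`),
independent in characteristic 0. Hence U(L) is not right noetherian; the anti-automorphism x ↦ -x
handles the left side. -/

namespace UniversalEnvelopingAlgebra

attribute [local instance 100] LieRing.ofAssociativeRing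

/-! ### Anti-automorphism and generation of enveloping algebras -/

section

variable (k L : Type*) [CommRing k] [LieRing L] [LieAlgebra k L]

/-- The principal anti-automorphism `x ↦ -x` of an enveloping algebra, as a map to the opposite
algebra. -/
noncomputable def toOpposite :
    UniversalEnvelopingAlgebra k L →ₐ[k] (UniversalEnvelopingAlgebra k L)ᵐᵒᵖ :=
  lift k
    { toFun := fun x => -MulOpposite.op (ι k x)
      map_add' := fun x y => by rw [map_add, MulOpposite.op_add, neg_add]
      map_smul' := fun c x => by simp
      map_lie' := fun {x y} => by
        apply MulOpposite.unop_injective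
        simp [Ring.lie_def, LieHom.map_lie] }

theorem toOpposite_ι (x : L) : toOpposite k L (ι k x) = -MulOpposite.op (ι k x) := by
  rw [toOpposite, lift_ι_apply]
  rfl

theorem unop_toOpposite_unop_toOpposite (u : UniversalEnvelopingAlgebra k L) :
    (toOpposite k L (toOpposite k L u).unop).unop = u := by
  have h : (AlgHom.opComm (toOpposite k L)).comp (toOpposite k L) = AlgHom.id k _ := by
    apply hom_ext
    apply LieHom.ext
    intro x
    change (toOpposite k L (toOpposite k L (ι k x)).unop).unop = ι k x
    rw [toOpposite_ι, MulOpposite.unop_neg, MulOpposite.unop_op, map_neg, toOpposite_ι, neg_neg,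
      MulOpposite.unop_op]
  exact DFunLike.congr_fun h u

theorem toOpposite_surjective : Function.Surjective (toOpposite k L) := fun y =>
  ⟨(toOpposite k L y.unop).unop,
    MulOpposite.unop_injective (unop_toOpposite_unop_toOpposite k L y.unop)⟩

/-- An enveloping algebra that is noetherian on the left is noetherian on the right. -/
theorem isRightNoetherian_of_isLeftNoetherian
    (h : IsLeftNoetherian (UniversalEnvelopingAlgebra k L)) :
    IsRightNoetherian (UniversalEnvelopingAlgebra k L) := by
  have : IsNoetherianRing (UniversalEnvelopingAlgebra k L) := h
  have h' : IsNoetherianRing (UniversalEnvelopingAlgebra k L)ᵐᵒᵖ :=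
    isNoetherianRing_of_surjective _ _ (toOpposite k L).toRingHom (toOpposite_surjective k L)
  let f : (UniversalEnvelopingAlgebra k L)ᵐᵒᵖ →ₗ[(UniversalEnvelopingAlgebra k L)ᵐᵒᵖ]
      UniversalEnvelopingAlgebra k L :=
    { toFun := MulOpposite.unop
      map_add' := fun _ _ => rfl
      map_smul' := fun _ _ => rfl }
  exact isNoetherian_of_surjective f (LinearMap.range_eq_top.2 MulOpposite.unop_surjective)

variable {k L}

/-- A subalgebra of `U(L)` containing the image of `L` is everything. -/
theorem eq_top_of_ι_mem (S : Subalgebra k (UniversalEnvelopingAlgebra k L))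
    (hS : ∀ x : L, ι k x ∈ S) : S = ⊤ := by
  let g : L →ₗ⁅k⁆ S :=
    { toFun := fun x => ⟨ι k x, hS x⟩
      map_add' := fun x y => Subtype.ext (map_add (ι k) x y)
      map_smul' := fun c x => Subtype.ext (map_smul (ι k) c x)
      map_lie' := fun {x y} => Subtype.ext ((ι k).map_lie x y) }
  have h : S.val.comp (lift k g) = AlgHom.id k _ := by
    apply hom_ext
    apply LieHom.ext
    intro x
    change ((lift k g (ι k x) : S) : UniversalEnvelopingAlgebra k L) = ι k x
    rw [lift_ι_apply]
    rfl
  refine eq_top_iff.2 fun u _ => ?_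
  have hu := DFunLike.congr_fun h u
  rw [AlgHom.comp_apply, AlgHom.id_apply] at hu
  rw [← hu]
  exact (lift k g u).2

end

end UniversalEnvelopingAlgebra

/-! ### The deformed Laurent polynomial representation -/

namespace WittAlgebra

noncomputable section

attribute [local instance 100] LieRing.ofAssociativeRing

open scoped DualNumber
open DualNumber (eps)

variable (k : Type*) [CommRing k]

/-- The action of `e n` on the first-order deformation `x ^ m ↦ (m + n ε) x ^ (m + n)` of the
module of Laurent polynomials, over the dual numbers. -/
def densityOperator (n : ℤ) : Module.End k[ε] (ℤ →₀ k[ε]) :=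
  Finsupp.linearCombination k[ε] fun m => Finsupp.single (m + n) ((m : k[ε]) + (n : k[ε]) * eps)

theorem densityOperator_single (n m : ℤ) (r : k[ε]) :
    densityOperator k n (Finsupp.single m r) =
      Finsupp.single (m + n) (r * ((m : k[ε]) + (n : k[ε]) * eps)) := by
  rw [densityOperator, Finsupp.linearCombination_single, Finsupp.smul_single, smul_eq_mul]

/-- The action of the Witt algebra on Laurent polynomials over the dual numbers. -/
def densityMap : WittAlgebra k →ₗ[k] Module.End k[ε] (ℤ →₀ k[ε]) :=
  (basis k).constr k (densityOperator k)

theorem densityMap_e (n : ℤ) : densityMap k (e k n) = densityOperator k n := by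
  simp only [densityMap, e, Module.Basis.constr_basis]

/-- The ε² terms cancel in the commutator, so ε could be any scalar here; its nilpotency matters
only later. -/
theorem densityMap_lie (x y : WittAlgebra k) :
    densityMap k ⁅x, y⁆ = ⁅densityMap k x, densityMap k y⁆ := by
  let B : Module.End k[ε] (ℤ →₀ k[ε]) →ₗ[k] Module.End k[ε] (ℤ →₀ k[ε]) →ₗ[k]
      Module.End k[ε] (ℤ →₀ k[ε]) := 
    LinearMap.mk₂ k (fun S T => S * T - T * S)
      (fun _ _ _ => by rw [add_mul, mul_add]; abel)
      (fun _ _ _ => LinearMap.ext fun v => by simp [smul_sub, LinearMap.map_smul_of_tower])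
      (fun _ _ _ => by rw [add_mul, mul_add]; abel)
      (fun _ _ _ => LinearMap.ext fun v => by simp [smul_sub, LinearMap.map_smul_of_tower])
  have h : (bracketMap k).compr₂ (densityMap k) = B.compl₁₂ (densityMap k) (densityMap k) := by
    refine (basis k).ext fun a => (basis k).ext fun b => ?_
    change densityMap k (bracketMap k (e k a) (e k b)) =
      densityMap k (e k a) * densityMap k (e k b) - densityMap k (e k b) * densityMap k (e k a)
    rw [bracketMap_e, map_smul, densityMap_e, densityMap_e, densityMap_e]
    refine Finsupp.lhom_ext fun m r => ?_
    rw [LinearMap.smul_apply, Int.cast_smul_eq_zsmul]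
    simp only [LinearMap.sub_apply, Module.End.mul_apply,
      densityOperator_single]
    rw [show m + b + a = m + (a + b) by ring, show m + a + b = m + (a + b) by ring,
      Finsupp.smul_single, ← Finsupp.single_sub]
    congr 1
    rw [zsmul_eq_mul]
    push_cast
    ring
  exact congrArg (fun f => f x y) h

/-- The representation of the Witt algebra on Laurent polynomials over the dual numbers. -/
def densityRep : WittAlgebra k →ₗ⁅k⁆ Module.End k[ε] (ℤ →₀ k[ε]) :=
  { densityMap k with map_lie' := fun {x y} => densityMap_lie k x y }

theorem densityRep_e (n : ℤ) : densityRep k (e k n) = densityOperator k n :=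
  densityMap_e k n

/-- The second difference of `e (n - j) * e j` in `j` acts as multiplication by `2 ε x ^ n`. -/
theorem densityOperator_second_difference (n m : ℤ) (r : k[ε]) :
    (densityOperator k (n - 1) * densityOperator k 1
      - (2 : k) • (densityOperator k (n - 2) * densityOperator k 2)
      + densityOperator k (n - 3) * densityOperator k 3) (Finsupp.single m r) =
    Finsupp.single (m + n) (2 * eps * r) := by
  have hsq : (eps : k[ε]) * eps = 0 := DualNumber.eps_mul_eps
  have h2 : ∀ v : ℤ →₀ k[ε], (2 : k) • v = (2 : ℤ) • v := fun v => by
    simpa using Int.cast_smul_eq_zsmul k 2 v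
  simp only [LinearMap.add_apply, LinearMap.sub_apply, LinearMap.smul_apply,
    Module.End.mul_apply, densityOperator_single, h2]
  rw [show m + 1 + (n - 1) = m + n by ring, show m + 2 + (n - 2) = m + n by ring,
    show m + 3 + (n - 3) = m + n by ring, Finsupp.smul_single, ← Finsupp.single_sub,
    ← Finsupp.single_add]
  congr 1
  rw [zsmul_eq_mul]
  push_cast
  -- The i² coefficient of (m + iε)(m + i + (n - i)ε) is ε - ε², so the second difference is 2ε -
  -- 2ε².
  linear_combination (-2 * r) * hsq

end

end WittAlgebra

/-! ### A right ideal that is not finitely generated -/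

namespace WittAlgebra

noncomputable section

attribute [local instance 100] LieRing.ofAssociativeRing

open scoped DualNumber
open DualNumber (eps)

variable {k : Type*} [Field k] {L : Type*} [LieRing L] [LieAlgebra k L]
  (j : L →ₗ⁅k⁆ WittAlgebra k)

/-- The action of `U(L)` on Laurent polynomials over the dual numbers obtained by restriction along
a homomorphism from `L` to the Witt algebra. -/
def envelopingRep : UniversalEnvelopingAlgebra k L →ₐ[k] Module.End k[ε] (ℤ →₀ k[ε]) :=
  UniversalEnvelopingAlgebra.lift k ((densityRep k).comp j)

theorem envelopingRep_ι (x : L) :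
    envelopingRep j (UniversalEnvelopingAlgebra.ι k x) = densityRep k (j x) := by
  rw [envelopingRep, UniversalEnvelopingAlgebra.lift_ι_apply]
  rfl

/-- Modulo `ε`, the constants are invariant under the Witt algebra. -/
theorem envelopingRep_one (b : UniversalEnvelopingAlgebra k L) :
    ∃ (c : k) (w : ℤ →₀ k[ε]), envelopingRep j b (Finsupp.single 0 1) =
      c • Finsupp.single 0 1 + (eps : k[ε]) • w := by
  let S : Subalgebra k (UniversalEnvelopingAlgebra k L) :=
    { carrier := {b | ∃ (c : k) (w : ℤ →₀ k[ε]), envelopingRep j b (Finsupp.single 0 1) =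
        c • Finsupp.single 0 1 + (eps : k[ε]) • w}
      algebraMap_mem' := fun c => ⟨c, 0, by simp [Module.algebraMap_end_apply]⟩
      add_mem' := by
        rintro a b ⟨c, w, h⟩ ⟨c', w', h'⟩
        refine ⟨c + c', w + w', ?_⟩
        rw [map_add, LinearMap.add_apply, h, h', add_smul, smul_add]
        abel
      mul_mem' := by
        rintro a b ⟨c, w, h⟩ ⟨c', w', h'⟩
        refine ⟨c' * c, c' • w + envelopingRep j a w', ?_⟩
        rw [map_mul, Module.End.mul_apply, h', map_add, LinearMap.map_smul_of_tower _ c', map_smul, h,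
          smul_add, smul_add, mul_smul, smul_comm c' (eps : k[ε]) w, add_assoc] }
  have hS : S = ⊤ := by
    refine UniversalEnvelopingAlgebra.eq_top_of_ι_mem S fun x => ?_
    have key : ∀ y : WittAlgebra k, ∃ w : ℤ →₀ k[ε],
        densityRep k y (Finsupp.single 0 1) = (eps : k[ε]) • w := fun y => by
      induction (basis k).mem_span y using Submodule.span_induction with
      | mem y hy =>
        obtain ⟨n, rfl⟩ := hy
        refine ⟨Finsupp.single n n, ?_⟩
        change densityRep k (e k n) _ = _
        rw [densityRep_e, densityOperator_single, Finsupp.smul_single]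
        simp [mul_comm]
      | zero => exact ⟨0, by simp⟩
      | add y z _ _ hy hz =>
        obtain ⟨w, hw⟩ := hy
        obtain ⟨w', hw'⟩ := hz
        exact ⟨w + w', by rw [map_add, LinearMap.add_apply, hw, hw', smul_add]⟩
      | smul c y _ hy =>
        obtain ⟨w, hw⟩ := hy
        exact ⟨c • w, by rw [map_smul, LinearMap.smul_apply, hw, smul_comm]⟩
    obtain ⟨w, hw⟩ := key (j x)
    exact ⟨0, w, by rw [envelopingRep_ι, hw, zero_smul, zero_add]⟩
  exact (hS ▸ Algebra.mem_top : b ∈ S)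

/-- The right ideal of elements of `U(L)` that act by zero modulo `ε`. -/
def epsIdeal : Submodule (UniversalEnvelopingAlgebra k L)ᵐᵒᵖ (UniversalEnvelopingAlgebra k L) where
  carrier := {u | ∀ v, (eps : k[ε]) • envelopingRep j u v = 0}
  add_mem' hu hu' v := by simp [hu v, hu' v]
  zero_mem' v := by simp
  smul_mem' b u hu v := by
    rw [MulOpposite.smul_eq_mul_unop, map_mul]
    exact hu _

/-- Modulo ε, b sends 1 to c·1, and u kills multiples of ε because it acts `k[ε]`-linearly. -/
theorem envelopingRep_mul_one {u : UniversalEnvelopingAlgebra k L} (hu : u ∈ epsIdeal j)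
    (b : UniversalEnvelopingAlgebra k L) :
    ∃ c : k, envelopingRep j (u * b) (Finsupp.single 0 1) =
      c • envelopingRep j u (Finsupp.single 0 1) := by
  obtain ⟨c, w, h⟩ := envelopingRep_one j b
  refine ⟨c, ?_⟩
  rw [map_mul, Module.End.mul_apply, h, map_add, LinearMap.map_smul_of_tower _ c,
    map_smul, hu w, add_zero]

/-- The elements of `epsIdeal j` whose value at `1` lies in a given subspace. -/
def epsIdealOfSubspace (T : Submodule k (ℤ →₀ k[ε])) :
    Submodule (UniversalEnvelopingAlgebra k L)ᵐᵒᵖ (UniversalEnvelopingAlgebra k L) where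
  carrier := {u | u ∈ epsIdeal j ∧ envelopingRep j u (Finsupp.single 0 1) ∈ T}
  add_mem' hu hu' := ⟨add_mem hu.1 hu'.1, by
    rw [map_add, LinearMap.add_apply]
    exact T.add_mem hu.2 hu'.2⟩
  zero_mem' := ⟨zero_mem _, by simp⟩
  smul_mem' b u hu := by
    refine ⟨(epsIdeal j).smul_mem b hu.1, ?_⟩
    obtain ⟨c, h⟩ := envelopingRep_mul_one j hu.1 b.unop
    rw [MulOpposite.smul_eq_mul_unop, h]
    exact T.smul_mem c hu.2

theorem exists_finiteDimensional_of_isRightNoetherian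
    (h : IsRightNoetherian (UniversalEnvelopingAlgebra k L)) :
    ∃ T : Submodule k (ℤ →₀ k[ε]), FiniteDimensional k T ∧
      ∀ u ∈ epsIdeal j, envelopingRep j u (Finsupp.single 0 1) ∈ T := by
  have : IsNoetherian (UniversalEnvelopingAlgebra k L)ᵐᵒᵖ (UniversalEnvelopingAlgebra k L) := h
  obtain ⟨S, hS⟩ := IsNoetherian.noetherian (epsIdeal j)
  let F : UniversalEnvelopingAlgebra k L → (ℤ →₀ k[ε]) :=
    fun u => envelopingRep j u (Finsupp.single 0 1)
  let T : Submodule k (ℤ →₀ k[ε]) := Submodule.span k (F '' S)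
  refine ⟨T, FiniteDimensional.span_of_finite k (S.finite_toSet.image F), fun u hu => ?_⟩
  -- The values of the generators span T, and right multiplication only rescales values at 1.
  have hle : epsIdeal j ≤ epsIdealOfSubspace j T := by
    rw [← hS, Submodule.span_le]
    intro s hs
    exact ⟨hS ▸ Submodule.subset_span hs, Submodule.subset_span ⟨s, hs, rfl⟩⟩
  exact (hle hu).2

theorem exists_mem_epsIdeal (hj : ∀ n : ℤ, 1 ≤ n → ∃ x, j x = e k n) (n : ℤ) (hn : 4 ≤ n) :
    ∃ u ∈ epsIdeal j,
      envelopingRep j u (Finsupp.single 0 1) = Finsupp.single n (2 * eps : k[ε]) := by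
  choose f hf using hj
  let E : ∀ i : ℤ, 1 ≤ i → UniversalEnvelopingAlgebra k L :=
    fun i hi => UniversalEnvelopingAlgebra.ι k (f i hi)
  have hE : ∀ i hi, envelopingRep j (E i hi) = densityOperator k i := fun i hi => by
    rw [envelopingRep_ι, hf, densityRep_e]
  -- The bound 4 ≤ n gives n - 3 ≥ 1, so every factor lifts to L.
  let u := E (n - 1) (by omega) * E 1 (by omega) - (2 : k) • (E (n - 2) (by omega) * E 2 (by omega))
    + E (n - 3) (by omega) * E 3 (by omega)
  have hu : ∀ m r, envelopingRep j u (Finsupp.single m r) =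
      Finsupp.single (m + n) (2 * eps * r) := fun m r => by
    rw [← densityOperator_second_difference]
    simp only [u, map_add, map_sub, map_smul, map_mul, hE]
  refine ⟨u, fun v => ?_, by simp [hu]⟩
  have h0 : (eps : k[ε]) • envelopingRep j u = 0 := by
    refine Finsupp.lhom_ext fun m r => ?_
    have hsq : (eps : k[ε]) * eps = 0 := DualNumber.eps_mul_eps
    rw [LinearMap.smul_apply, hu, Finsupp.smul_single, smul_eq_mul,
      show (eps : k[ε]) * (2 * eps * r) = 2 * r * (eps * eps) by ring, hsq]
    simp
  exact DFunLike.congr_fun h0 v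

theorem linearIndependent_single_two_eps [CharZero k] :
    LinearIndependent k
      fun n : ℕ => (Finsupp.single (n + 4 : ℤ) (2 * eps : k[ε]) : ℤ →₀ k[ε]) := by
  -- Characteristic 0 enters here: 2ε would vanish in characteristic 2.
  have h0 : (2 * eps : k[ε]) ≠ 0 := fun h => by
    rw [two_mul] at h
    simpa [add_self_eq_zero] using congrArg TrivSqZeroExt.snd h
  exact (Finsupp.linearIndependent_single (φ := fun _ : ℤ => Unit) (fun _ _ => (2 * eps : k[ε]))
    fun _ => LinearIndependent.of_subsingleton () h0).comp
      (fun n : ℕ => ⟨(n + 4 : ℤ), ()⟩) fun a b hab => by simpa using hab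

/-- The enveloping algebra of a Lie algebra over the Witt algebra whose image contains all `e n`
with `1 ≤ n` is not right noetherian. -/
theorem not_isRightNoetherian [CharZero k] (hj : ∀ n : ℤ, 1 ≤ n → ∃ x, j x = e k n) :
    ¬ IsRightNoetherian (UniversalEnvelopingAlgebra k L) := by
  intro h
  obtain ⟨T, hT, hmem⟩ := exists_finiteDimensional_of_isRightNoetherian j h
  have hli := linearIndependent_single_two_eps (k := k)
  have hn : ∀ n : ℕ, (Finsupp.single (n + 4 : ℤ) (2 * eps : k[ε]) : ℤ →₀ k[ε]) ∈ T := fun n => by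
    obtain ⟨u, hu, h⟩ := exists_mem_epsIdeal j hj (n + 4) (by omega)
    exact h ▸ hmem u hu
  have hli' : LinearIndependent k fun n : ℕ => (⟨_, hn n⟩ : T) :=
    LinearIndependent.of_comp T.subtype hli
  exact not_finite_iff_infinite.2 inferInstance hli'.finite

theorem not_isLeftNoetherian [CharZero k] (hj : ∀ n : ℤ, 1 ≤ n → ∃ x, j x = e k n) :
    ¬ IsLeftNoetherian (UniversalEnvelopingAlgebra k L) := fun h =>
  not_isRightNoetherian j hj
    (UniversalEnvelopingAlgebra.isRightNoetherian_of_isLeftNoetherian k L h)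

theorem not_finite (hj : ∀ n : ℤ, 1 ≤ n → ∃ x, j x = e k n) : ¬ Module.Finite k L := by
  intro h
  have hj' : ∀ n : ℕ, ∃ x, j x = e k (n + 1) := fun n => hj (n + 1) (by omega)
  choose f hf using hj'
  have hli : LinearIndependent k fun n : ℕ => (j : L →ₗ[k] WittAlgebra k) (f n) := by
    have : (fun n : ℕ => (j : L →ₗ[k] WittAlgebra k) (f n)) =
        basis k ∘ fun n : ℕ => (n + 1 : ℤ) := funext hf
    rw [this]
    exact (basis k).linearIndependent.comp _ fun a b hab => by simpa using hab
  have hli' : LinearIndependent k f := LinearIndependent.of_comp (j : L →ₗ[k] WittAlgebra k) hli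
  exact not_finite_iff_infinite.2 inferInstance hli'.finite

theorem exists_positive_incl_eq (n : ℤ) (hn : 1 ≤ n) :
    ∃ x, (positive k).incl x = e k n :=
  ⟨⟨e k n, LieSubalgebra.subset_lieSpan ⟨n, hn, rfl⟩⟩, rfl⟩

end

end WittAlgebra

theorem theorem0p3 (k : Type*) [Field k] [CharZero k] :
    (¬ IsLeftNoetherian (UniversalEnvelopingAlgebra k (WittAlgebra.positive k)) ∧
      ¬ IsRightNoetherian (UniversalEnvelopingAlgebra k (WittAlgebra.positive k))) ∧
    (¬ IsLeftNoetherian (UniversalEnvelopingAlgebra k (WittAlgebra k)) ∧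
      ¬ IsRightNoetherian (UniversalEnvelopingAlgebra k (WittAlgebra k))) ∧
    (Module.Finite k (WittAlgebra.positive k) ↔
      IsLeftNoetherian (UniversalEnvelopingAlgebra k (WittAlgebra.positive k)) ∧
        IsRightNoetherian (UniversalEnvelopingAlgebra k (WittAlgebra.positive k))) ∧
    (Module.Finite k (WittAlgebra k) ↔
      IsLeftNoetherian (UniversalEnvelopingAlgebra k (WittAlgebra k)) ∧
        IsRightNoetherian (UniversalEnvelopingAlgebra k (WittAlgebra k))) := by
  have hp := WittAlgebra.exists_positive_incl_eq (k := k)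
  have hw : ∀ n : ℤ, 1 ≤ n → ∃ x, (LieHom.id : WittAlgebra k →ₗ⁅k⁆ WittAlgebra k) x =
      WittAlgebra.e k n := fun n _ => ⟨_, rfl⟩
  have hpl := WittAlgebra.not_isLeftNoetherian _ hp
  have hwl := WittAlgebra.not_isLeftNoetherian _ hw
  exact ⟨⟨hpl, WittAlgebra.not_isRightNoetherian _ hp⟩,
    ⟨hwl, WittAlgebra.not_isRightNoetherian _ hw⟩,
    iff_of_false (WittAlgebra.not_finite _ hp) fun h => hpl h.1,
    iff_of_false (WittAlgebra.not_finite _ hw) fun h => hwl h.1⟩
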